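/- Let $1\le k\le N$ be integers, $n=\lceil N/k\rceil$ and $\ell=nk-N$. Let $\mathcal J_{k,N}$ be the set of Hermitian matrices $\mathbf J\in\mathbb C^{N\times N}$ that are block tridiagonal with Hermitian diagonal blocks $\mathbf A_0,\dots,\mathbf A_{n-2}\in\mathbb C^{k\times k}$, $\mathbf A_{n-1}\in\mathbb C^{(k-\ell)\times(k-\ell)}$ and full-rank subdiagonal blocks $\mathbf B_0,\dots,\mathbf B_{n-3}\in\mathbb C^{k\times k}$, $\mathbf B_{n-2}\in\mathbb C^{(k-\ell)\times k}$ (and superdiagonal blocks $\mathbf B_j^*$), such that $\mathbf B_0,\dots,\mathbf B_{n-3}$ are upper triangular with strictly positive diagonal entries and $\mathbf B_{n-2}$ is in row echelon form with positive leading entries. The spectral measure of $\mathbf J\in\mathcal J_{k,N}$ is the $k\times k$ matrix-valued measure $\varphi(\mathbf J)=\sum_{j=1}^N \mathbf v_j\mathbf v_j^*\,\delta_{\lambda_j}$ on $\mathbb R$, where $\lambda_1,\dots,\lambda_N$ are the eigenvalues of $\mathbf J$, with multiplicity, and $\mathbf v_j\in\mathbb C^k$ consists of the first $k$ components of the $j$-th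 vector of a corresponding orthonormal basis of eigenvectors (the measure does not depend on the choice of this basis). Let $\boldsymbol\mu=\sum_{j=1}^m \mathbf V_j\mathbf V_j^*\,\delta_{x_j}$, where the points $x_1,\dots,x_m\in\mathbb R$ are distinct, $\mathbf V_j\in\mathbb C^{k\times n_j}$ with $n_j\le k$, and $\sum_{j=1}^m n_j=N$, and suppose that $\boldsymbol\mu$ is normalized, i.e. $\boldsymbol\mu(\mathbb R)=\sum_{j=1}^m\mathbf V_j\mathbf V_j^*=\mathbf I_k$. Define $$\mathbf X=\mathrm{diag}(\underbrace{x_1,\dots,x_1}_{n_1},\dots,\underbrace{x_m,\dots,x_m}_{n_m})\in\mathbb C^{N\times N},\qquad \mathbf V^*=\begin{bmatrix}\mathbf V_1&\cdots&\mathbf V_m\end{bmatrix},\quad \mathbf V\in\mathbb C^{N\times k}.$$ Then $\boldsymbol\mu$ is the spectral measure of some matrix in $\mathcal J_{k,N}$ if and only if, for every integer $d\ge 0$, the matrix $$\begin{bmatrix}\mathbf V&\mathbf X\mathbf V&\cdots&\mathbf X^d\mathbf V\end{bmatrix}\in\mathbb C^{N\times(d+1)k}$$ has full rank, i.e. rank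 $\min\{(d+1)k,N\}$. -/

import Mathlib

open MeasureTheory
open scoped Matrix ComplexOrder

noncomputable section

namespace BandedSpectral

/-- A matrix has full rank: its rank is the smaller of its two dimensions. -/
def HasFullRank {p q : Type*} [Fintype p] [Fintype q] (M : Matrix p q ℂ) : Prop :=
  M.rank = min (Fintype.card p) (Fintype.card q)

/-! ### Matrix-valued measures on the real line -/

/-- Countably additive set functions on the Borel sets of `ℝ` with values in `ℂ^{k×k}`. -/
abbrev MatrixMeasure (k : ℕ) : Type := VectorMeasure ℝ (Matrix (Fin k) (Fin k) ℂ)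

/-- `μ` takes positive semidefinite values and is normalized, `μ(ℝ) = I`. -/
def IsNormalizedMeasure {k : ℕ} (μ : MatrixMeasure k) : Prop :=
  (∀ s, MeasurableSet s → (μ s).PosSemidef) ∧ μ Set.univ = 1

/-- The finite matrix measure `∑ j, W j δ_{x j}`. -/
def atomicMeasure {ι : Type*} [Fintype ι] {k : ℕ} (x : ι → ℝ)
    (W : ι → Matrix (Fin k) (Fin k) ℂ) : MatrixMeasure k :=
  ∑ j, VectorMeasure.dirac (x j) (W j)

/-! ### The class of banded matrices -/

/-- The size of the `b`-th block (counted from `0`) when `0, …, N - 1` is cut into consecutive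
blocks of length `k`, the last one possibly shorter. -/
def blockSize (k N b : ℕ) : ℕ := min k (N - b * k)

/-- The position in `0, …, N - 1` of the `r`-th element of the `b`-th block. -/
def blockIndex (k N b : ℕ) (r : Fin (blockSize k N b)) : Fin N :=
  ⟨b * k + r, by have h := r.isLt; unfold blockSize at h; omega⟩

/-- The block of `J` in block row `a` and block column `b`. -/
def block {k N : ℕ} (J : Matrix (Fin N) (Fin N) ℂ) (a b : ℕ) :
    Matrix (Fin (blockSize k N a)) (Fin (blockSize k N b)) ℂ :=
  J.submatrix (blockIndex k N a) (blockIndex k N b)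

/-- Membership in the class `𝒥_{k,N}`. With `n = ⌈N/k⌉` blocks, `block J j j` is `A_j` for
`j ≤ n - 1` and `block J (j + 1) j` is `B_j` for `j ≤ n - 2`. -/
structure IsBanded (k N : ℕ) (J : Matrix (Fin N) (Fin N) ℂ) : Prop where
  isHermitian : J.IsHermitian
  diag_isHermitian : ∀ j < N ⌈/⌉ k, (block (k := k) J j j).IsHermitian
  tridiagonal : ∀ a < N ⌈/⌉ k, ∀ b < N ⌈/⌉ k, (a + 1 < b ∨ b + 1 < a) → block (k := k) J a b = 0
  fullRank : ∀ j, j + 1 < N ⌈/⌉ k → HasFullRank (block (k := k) J (j + 1) j)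
  upperTriangular : ∀ j, j + 2 < N ⌈/⌉ k → ∀ r c, c.val < r.val → block (k := k) J (j + 1) j r c = 0
  diag_pos : ∀ j, j + 2 < N ⌈/⌉ k → ∀ r c, r.val = c.val → 0 < block (k := k) J (j + 1) j r c
  last_isRowEchelon : ∀ j, j + 2 = N ⌈/⌉ k → (block (k := k) J (j + 1) j).IsRowEchelon
  last_pivot_pos : ∀ j, j + 2 = N ⌈/⌉ k → ∀ r c,
    (block (k := k) J (j + 1) j).IsLeadingEntry r c → 0 < block (k := k) J (j + 1) j r c

/-- The spectral measure `∑ j, v_j v_j^* δ_{λ_j}` of a Hermitian matrix: the `λ_j` are its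
eigenvalues (with multiplicity) and `v_j` is made of the first `k` components of the `j`-th vector
of an orthonormal eigenbasis. -/
def spectralMeasure {k N : ℕ} (hkN : k ≤ N) (J : Matrix (Fin N) (Fin N) ℂ) (hJ : J.IsHermitian) :
    MatrixMeasure k :=
  atomicMeasure hJ.eigenvalues fun j =>
    let v : Fin k → ℂ := fun i => hJ.eigenvectorBasis j (Fin.castLE hkN i)
    Matrix.vecMulVec v (star v)

/-! ### The block Krylov matrices -/

section Krylov

variable {m k : ℕ} {n : Fin m → ℕ}

/-- `X = diag(x_1, …, x_1, …, x_m, …, x_m)`, with `x_j` repeated `n_j` times. -/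
def pointMatrix (n : Fin m → ℕ) (x : Fin m → ℝ) :
    Matrix (Σ j, Fin (n j)) (Σ j, Fin (n j)) ℂ :=
  Matrix.diagonal fun p => (x p.1 : ℂ)

/-- The matrix `V` with `k` columns such that `V^* = [V_1 ⋯ V_m]`. -/
def stackedMatrix (V : ∀ j, Matrix (Fin k) (Fin (n j)) ℂ) : Matrix (Σ j, Fin (n j)) (Fin k) ℂ :=
  (Matrix.of fun i (p : Σ j, Fin (n j)) => V p.1 i p.2)ᴴ

/-- The matrix `[V, X V, …, X^d V]`. -/
def krylovMatrix (x : Fin m → ℝ) (V : ∀ j, Matrix (Fin k) (Fin (n j)) ℂ) (d : ℕ) :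
    Matrix (Σ j, Fin (n j)) (Fin (d + 1) × Fin k) ℂ :=
  Matrix.of fun p c => (pointMatrix n x ^ (c.1 : ℕ) * stackedMatrix V) p c.2

end Krylov

end BandedSpectral

end
/-!
A finitely supported measure is determined by its moments, and the `i`-th moment of the spectral
measure of `J` is the leading `k × k` block of `J ^ i`. So the question is whether some
`J ∈ 𝒥_{k,N}` satisfies `E^* J^i E = V^* X^i V` for all `i`, where `E` consists of the first `k`
columns of the identity.

These moments are the entries of the Gram matrix of the Krylov matrix, so `[V, X V, …]` and
`[E, J E, …]` have the same rank. If `J` is banded, the subdiagonal blocks are surjective, and by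
induction the columns of `[E, J E, …, J^d E]` span the first `(d + 1) k` coordinate vectors.

Conversely, list the columns of all the Krylov matrices as one sequence `f` with
`f (t + k) = X (f t)`, apply Gram–Schmidt and drop the zero vectors. In the resulting basis `X`
maps the vector coming from position `t` into the span of those from positions at most `t + k`,
with a positive coefficient at `t + k` if that position survives. Full rank says that exactly
`min N (d k)` of the first `d k` positions survive, which makes the surviving positions break up
into blocks in the way the definition of `𝒥_{k,N}` demands.
-/


noncomputable section

namespace BandedSpectral

/-! ### Atomic measures and their moments -/

section Atomic

variable {ι κ : Type*} [Fintype ι] [Fintype κ] {k : ℕ}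

theorem atomicMeasure_apply (x : ι → ℝ) (W : ι → Matrix (Fin k) (Fin k) ℂ) {s : Set ℝ}
    (hs : MeasurableSet s) :
    atomicMeasure x W s = ∑ j, s.indicator (fun _ => (1 : ℂ)) (x j) • W j := by
  rw [atomicMeasure, FunLike.coe_sum, Finset.sum_apply]
  refine Finset.sum_congr rfl fun j _ => ?_
  by_cases hj : x j ∈ s <;> simp [hs, hj]

theorem atomicMeasure_univ (x : ι → ℝ) (W : ι → Matrix (Fin k) (Fin k) ℂ) :
    atomicMeasure x W Set.univ = ∑ j, W j := by
  simp [atomicMeasure_apply x W MeasurableSet.univ]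

theorem sum_smul_eq_sum_smul_atomicMeasure_singleton (x : ι → ℝ)
    (W : ι → Matrix (Fin k) (Fin k) ℂ) (h : ℝ → ℂ) {T : Finset ℝ} (hT : ∀ j, x j ∈ T) :
    ∑ j, h (x j) • W j = ∑ y ∈ T, h y • atomicMeasure x W {y} := by
  simp_rw [atomicMeasure_apply x W (MeasurableSet.singleton _), Finset.smul_sum]
  rw [Finset.sum_comm]
  refine Finset.sum_congr rfl fun j _ => ?_
  rw [Finset.sum_eq_single (x j)]
  · simp
  · intro y _ hy
    simp [Set.indicator_of_notMem (s := {y}) (a := x j) (by simpa using hy.symm)]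
  · exact fun hj => absurd (hT j) hj

theorem atomicMeasure_eq_iff_moments (x : ι → ℝ) (W : ι → Matrix (Fin k) (Fin k) ℂ) (y : κ → ℝ)
    (Z : κ → Matrix (Fin k) (Fin k) ℂ) :
    atomicMeasure x W = atomicMeasure y Z ↔
      ∀ i : ℕ, ∑ j, (x j : ℂ) ^ i • W j = ∑ j, (y j : ℂ) ^ i • Z j := by
  classical
  set T : Finset ℝ := Finset.univ.image x ∪ Finset.univ.image y with hT
  have hx : ∀ j, x j ∈ T := fun j => by simp [hT]
  have hy : ∀ j, y j ∈ T := fun j => by simp [hT]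
  refine ⟨fun h i => ?_, fun h => ?_⟩
  · rw [sum_smul_eq_sum_smul_atomicMeasure_singleton x W (fun t => (t : ℂ) ^ i) hx, h,
      sum_smul_eq_sum_smul_atomicMeasure_singleton y Z (fun t => (t : ℂ) ^ i) hy]
  have hpoly : ∀ P : Polynomial ℂ, ∑ j, P.eval (x j : ℂ) • W j = ∑ j, P.eval (y j : ℂ) • Z j := by
    intro P
    simp_rw [Polynomial.eval_eq_sum_range, Finset.sum_smul]
    rw [Finset.sum_comm, Finset.sum_comm (s := (Finset.univ : Finset κ))]
    refine Finset.sum_congr rfl fun i _ => ?_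
    simp_rw [mul_smul, ← Finset.smul_sum, h i]
  ext1 s hs
  set P := Lagrange.interpolate T (fun t : ℝ => (t : ℂ)) (s.indicator fun _ => (1 : ℂ))
  have hP : ∀ t ∈ T, P.eval (t : ℂ) = s.indicator (fun _ => (1 : ℂ)) t := fun t ht =>
    Lagrange.eval_interpolate_at_node (v := fun t : ℝ => (t : ℂ)) _
      Complex.ofReal_injective.injOn ht
  rw [atomicMeasure_apply x W hs, atomicMeasure_apply y Z hs]
  simpa only [hP _ (hx _), hP _ (hy _)] using hpoly P

end Atomic

theorem sum_eigenvalues_pow_smul_vecMulVec {k N : ℕ} (hkN : k ≤ N) {J : Matrix (Fin N) (Fin N) ℂ}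
    (hJ : J.IsHermitian) (i : ℕ) :
    (∑ j, (hJ.eigenvalues j : ℂ) ^ i •
      Matrix.vecMulVec (fun a : Fin k => hJ.eigenvectorBasis j (Fin.castLE hkN a))
        (star fun a : Fin k => hJ.eigenvectorBasis j (Fin.castLE hkN a))) =
      (J ^ i).submatrix (Fin.castLE hkN) (Fin.castLE hkN) := by
  have hpow : J ^ i = (hJ.eigenvectorUnitary : Matrix (Fin N) (Fin N) ℂ) *
      Matrix.diagonal (fun j => (hJ.eigenvalues j : ℂ) ^ i) *
        star (hJ.eigenvectorUnitary : Matrix (Fin N) (Fin N) ℂ) := by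
    conv_lhs => rw [hJ.spectral_theorem, ← map_pow, Matrix.diagonal_pow]
    rw [Unitary.conjStarAlgAut_apply]
    rfl
  ext a b
  rw [hpow, Matrix.sum_apply, Matrix.submatrix_apply, Matrix.mul_apply]
  refine Finset.sum_congr rfl fun j _ => ?_
  simp only [Matrix.smul_apply, Matrix.vecMulVec_apply, smul_eq_mul, Matrix.mul_diagonal,
    Matrix.star_apply, Pi.star_apply, Matrix.IsHermitian.eigenvectorUnitary_apply]
  ring

section PointMatrix

variable {m k : ℕ} {n : Fin m → ℕ} (x : Fin m → ℝ) (V : ∀ j, Matrix (Fin k) (Fin (n j)) ℂ)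

theorem isHermitian_pointMatrix (n : Fin m → ℕ) : (pointMatrix n x).IsHermitian :=
  Matrix.isHermitian_diagonal_of_self_adjoint _ (funext fun _ => Complex.conj_ofReal _)

theorem sum_pow_smul_mul_conjTranspose (i : ℕ) :
    ∑ j, (x j : ℂ) ^ i • (V j * (V j)ᴴ) =
      (stackedMatrix V)ᴴ * pointMatrix n x ^ i * stackedMatrix V := by
  ext a b
  rw [Matrix.sum_apply, pointMatrix, Matrix.diagonal_pow, Matrix.mul_apply, Fintype.sum_sigma]
  refine Finset.sum_congr rfl fun j _ => ?_
  rw [Matrix.smul_apply, Matrix.mul_apply, smul_eq_mul, Finset.mul_sum]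
  refine Finset.sum_congr rfl fun y _ => ?_
  rw [Matrix.mul_diagonal, stackedMatrix, Matrix.conjTranspose_conjTranspose]
  simp only [Matrix.conjTranspose_apply, Matrix.of_apply, Pi.pow_apply]
  ring

theorem conjTranspose_stackedMatrix_mul_self :
    (stackedMatrix V)ᴴ * stackedMatrix V = ∑ j, V j * (V j)ᴴ := by
  simpa using (sum_pow_smul_mul_conjTranspose (fun _ => 0) V 0).symm

theorem spectralMeasure_eq_atomicMeasure_iff {N : ℕ} (hkN : k ≤ N) {J : Matrix (Fin N) (Fin N) ℂ}
    (hJ : J.IsHermitian) :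
    spectralMeasure hkN J hJ = atomicMeasure x (fun j => V j * (V j)ᴴ) ↔
      ∀ i : ℕ, (J ^ i).submatrix (Fin.castLE hkN) (Fin.castLE hkN) =
        (stackedMatrix V)ᴴ * pointMatrix n x ^ i * stackedMatrix V := by
  rw [spectralMeasure, atomicMeasure_eq_iff_moments]
  refine forall_congr' fun i => ?_
  rw [sum_pow_smul_mul_conjTranspose, ← sum_eigenvalues_pow_smul_vecMulVec hkN hJ i]

end PointMatrix

/-! ### Gram–Schmidt orthonormalization of a dependent family -/

section GramSchmidt

open InnerProductSpace Submodule

variable {𝕜 E : Type*} [RCLike 𝕜] [NormedAddCommGroup E] [InnerProductSpace 𝕜 E]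

section LinearOrder

variable {ι : Type*} [LinearOrder ι] [LocallyFiniteOrderBot ι] [WellFoundedLT ι] (f : ι → E)

theorem sub_gramSchmidt_mem_span_image_Iio (t : ι) :
    f t - gramSchmidt 𝕜 f t ∈ span 𝕜 (f '' Set.Iio t) := by
  rw [gramSchmidt_def, sub_sub_cancel, ← span_gramSchmidt_Iio 𝕜 f t]
  refine Submodule.sum_mem _ fun i hi =>
    span_mono ?_ (starProjection_apply_mem (𝕜 ∙ gramSchmidt 𝕜 f i) (f t))
  exact Set.singleton_subset_iff.2 (Set.mem_image_of_mem _ (Finset.mem_Iio.1 hi))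

theorem inner_gramSchmidtNormed_eq_zero_of_mem_span {t : ι} {v : E}
    (hv : v ∈ span 𝕜 (f '' Set.Iio t)) : inner 𝕜 (gramSchmidtNormed 𝕜 f t) v = 0 := by
  have hle : span 𝕜 (f '' Set.Iio t) ≤ (𝕜 ∙ gramSchmidt 𝕜 f t)ᗮ := by
    refine span_le.2 ?_
    rintro _ ⟨i, hi, rfl⟩
    exact mem_orthogonal_singleton_iff_inner_right.2 (gramSchmidt_inv_triangular 𝕜 f hi)
  rw [gramSchmidtNormed, inner_smul_left,
    mem_orthogonal_singleton_iff_inner_right.1 (hle hv), mul_zero]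

theorem inner_gramSchmidtNormed_self (t : ι) :
    inner 𝕜 (gramSchmidtNormed 𝕜 f t) (f t) = (‖gramSchmidt 𝕜 f t‖ : 𝕜) := by
  have h := inner_gramSchmidtNormed_eq_zero_of_mem_span f
    (sub_gramSchmidt_mem_span_image_Iio (𝕜 := 𝕜) f t)
  rw [inner_sub_right, sub_eq_zero] at h
  rw [h, gramSchmidtNormed, inner_smul_left, inner_self_eq_norm_sq_to_K, map_inv₀,
    RCLike.conj_ofReal, sq, ← mul_assoc, inv_mul_mul_self]

theorem gramSchmidt_eq_self_of_inner_eq_zero {t : ι} (h : ∀ i < t, inner 𝕜 (f i) (f t) = 0) :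
    gramSchmidt 𝕜 f t = f t := by
  have hle : span 𝕜 (f '' Set.Iio t) ≤ (𝕜 ∙ f t)ᗮ := by
    refine span_le.2 ?_
    rintro _ ⟨i, hi, rfl⟩
    exact mem_orthogonal_singleton_iff_inner_left.2 (h i hi)
  rw [gramSchmidt_def, sub_eq_self]
  refine Finset.sum_eq_zero fun i hi => ?_
  have hi' : gramSchmidt 𝕜 f i ∈ span 𝕜 (f '' Set.Iio t) := by
    rw [← span_gramSchmidt_Iio 𝕜 f t]
    exact subset_span (Set.mem_image_of_mem _ (Finset.mem_Iio.1 hi))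
  rw [starProjection_singleton, mem_orthogonal_singleton_iff_inner_left.1 (hle hi'), zero_div,
    zero_smul]

end LinearOrder

theorem gramSchmidtNormed_mem_span_image_Iio_succ (f : ℕ → E) (t : ℕ) :
    gramSchmidtNormed 𝕜 f t ∈ span 𝕜 (f '' Set.Iio (t + 1)) := by
  rw [← span_gramSchmidt_Iio 𝕜 f, ← span_gramSchmidtNormed]
  exact subset_span (Set.mem_image_of_mem _ t.lt_succ_self)

theorem finrank_span_image_Iio_eq_count (f : ℕ → E)
    [DecidablePred fun i => gramSchmidtNormed 𝕜 f i ≠ 0] (t : ℕ) :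
    Module.finrank 𝕜 (span 𝕜 (f '' Set.Iio t)) =
      Nat.count (fun i => gramSchmidtNormed 𝕜 f i ≠ 0) t := by
  set S : Finset ℕ := {i ∈ Finset.range t | gramSchmidtNormed 𝕜 f i ≠ 0} with hS
  have hli : LinearIndependent 𝕜 fun i : S => gramSchmidtNormed 𝕜 f i :=
    ((gramSchmidtNormed_orthonormal' (𝕜 := 𝕜) f).comp
      (fun i : S => ⟨i, (Finset.mem_filter.1 i.2).2⟩)
      fun i j h => Subtype.ext (Subtype.mk.inj h)).linearIndependent
  have hrange : Set.range (fun i : S => gramSchmidtNormed 𝕜 f i) =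
      gramSchmidtNormed 𝕜 f '' Set.Iio t \ {0} := by
    ext v
    constructor
    · rintro ⟨⟨i, hi⟩, rfl⟩
      rw [hS, Finset.mem_filter, Finset.mem_range] at hi
      exact ⟨⟨i, hi.1, rfl⟩, hi.2⟩
    · rintro ⟨⟨i, hi, rfl⟩, h0⟩
      exact ⟨⟨i, Finset.mem_filter.2 ⟨Finset.mem_range.2 hi, h0⟩⟩, rfl⟩
  rw [Nat.count_eq_card_filter_range, ← hS, ← Fintype.card_coe, ← finrank_span_eq_card hli, hrange,
    span_sdiff_singleton_zero, span_gramSchmidtNormed, span_gramSchmidt_Iio]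

theorem exists_orthonormalBasis_gramSchmidtNormed [FiniteDimensional 𝕜 E] (f : ℕ → E) {N L : ℕ}
    (hN : Module.finrank 𝕜 E = N) (hL : Module.finrank 𝕜 (span 𝕜 (f '' Set.Iio L)) = N) :
    ∃ (q : OrthonormalBasis (Fin N) 𝕜 E) (p : Fin N → ℕ), StrictMono p ∧
      (∀ s, q s = gramSchmidtNormed 𝕜 f (p s)) ∧
      ∀ s t, p s < t ↔ (s : ℕ) < Module.finrank 𝕜 (span 𝕜 (f '' Set.Iio t)) := by
  classical
  set P : ℕ → Prop := fun i => gramSchmidtNormed 𝕜 f i ≠ 0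
  have hcount : ∀ t, Module.finrank 𝕜 (span 𝕜 (f '' Set.Iio t)) = Nat.count P t :=
    finrank_span_image_Iio_eq_count f
  have hcard : ∀ s : Fin N, ∀ hP : (Set.ofPred P).Finite, (s : ℕ) < hP.toFinset.card := fun s hP =>
    (s.2.trans_eq (hL.symm.trans (hcount L))).trans_le (Nat.count_le_card hP L)
  let p : Fin N → ℕ := fun s => Nat.nth P s
  have hp : StrictMono p := fun s r hsr => Nat.nth_lt_nth' hsr (hcard r)
  have hq : Orthonormal 𝕜 fun s => gramSchmidtNormed 𝕜 f (p s) :=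
    (gramSchmidtNormed_orthonormal' (𝕜 := 𝕜) f).comp (fun s => ⟨p s, Nat.nth_mem _ (hcard s)⟩)
      fun s r hsr => hp.injective (congrArg Subtype.val hsr)
  have hspan : ⊤ ≤ span 𝕜 (Set.range fun s => gramSchmidtNormed 𝕜 f (p s)) :=
    (hq.linearIndependent.span_eq_top_of_card_eq_finrank' (by rw [Fintype.card_fin, hN])).ge
  refine ⟨OrthonormalBasis.mk hq hspan, p, hp, fun s => by rw [OrthonormalBasis.coe_mk],
    fun s t => ?_⟩
  rw [hcount]
  refine ⟨fun hst => ?_, Nat.nth_lt_of_lt_count⟩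
  have h := Nat.count_strict_mono (Nat.nth_mem (p := P) s (hcard s)) hst
  rwa [Nat.count_nth (hcard s)] at h

end GramSchmidt

/-! ### Block Krylov matrices -/

/-- The block Krylov matrix `[B, A B, …, A^d B]`. -/
def blockKrylov {R ι κ : Type*} [Semiring R] [Fintype ι] [DecidableEq ι] (A : Matrix ι ι R)
    (B : Matrix ι κ R) (d : ℕ) : Matrix ι (Fin (d + 1) × κ) R :=
  Matrix.of fun p c => (A ^ (c.1 : ℕ) * B) p c.2

theorem conjTranspose_blockKrylov_mul_self {R ι κ : Type*} [Semiring R] [StarRing R] [Fintype ι]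
    [DecidableEq ι] {A : Matrix ι ι R} (hA : A.IsHermitian) (B : Matrix ι κ R) (d : ℕ) :
    (blockKrylov A B d)ᴴ * blockKrylov A B d =
      Matrix.of fun c c' => (Bᴴ * A ^ ((c.1 : ℕ) + (c'.1 : ℕ)) * B) c.2 c'.2 := by
  ext c c'
  have h : Bᴴ * A ^ ((c.1 : ℕ) + (c'.1 : ℕ)) * B =
      (A ^ (c.1 : ℕ) * B)ᴴ * (A ^ (c'.1 : ℕ) * B) := by
    rw [Matrix.conjTranspose_mul, Matrix.conjTranspose_pow, hA.eq, pow_add]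
    simp only [Matrix.mul_assoc]
  rw [Matrix.of_apply, h, Matrix.mul_apply, Matrix.mul_apply]
  rfl

theorem rank_blockKrylov_eq_of_moments {𝕜 ι ι' κ : Type*} [RCLike 𝕜] [Fintype ι] [DecidableEq ι]
    [Fintype ι'] [DecidableEq ι'] [Fintype κ] {A : Matrix ι ι 𝕜} (hA : A.IsHermitian)
    {B : Matrix ι κ 𝕜} {A' : Matrix ι' ι' 𝕜} (hA' : A'.IsHermitian) {B' : Matrix ι' κ 𝕜}
    (h : ∀ i : ℕ, Bᴴ * A ^ i * B = B'ᴴ * A' ^ i * B') (d : ℕ) :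
    (blockKrylov A B d).rank = (blockKrylov A' B' d).rank := by
  rw [← Matrix.rank_conjTranspose_mul_self, conjTranspose_blockKrylov_mul_self hA,
    ← Matrix.rank_conjTranspose_mul_self (blockKrylov A' B' d),
    conjTranspose_blockKrylov_mul_self hA']
  simp_rw [h]

section Shift

open InnerProductSpace Submodule

variable {𝕜 E : Type*} [RCLike 𝕜] [NormedAddCommGroup E] [InnerProductSpace 𝕜 E]
  {f : ℕ → E} {T : E →ₗ[𝕜] E} {k : ℕ}

theorem map_mem_span_image_Iio_of_shift (hf : ∀ t, f (t + k) = T (f t)) {t : ℕ} {v : E}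
    (hv : v ∈ span 𝕜 (f '' Set.Iio t)) : T v ∈ span 𝕜 (f '' Set.Iio (t + k)) := by
  have hle : span 𝕜 (f '' Set.Iio t) ≤ (span 𝕜 (f '' Set.Iio (t + k))).comap T := by
    refine span_le.2 ?_
    rintro _ ⟨i, hi, rfl⟩
    exact subset_span ⟨i + k, Nat.add_lt_add_right hi k, hf i⟩
  exact hle hv

theorem inner_gramSchmidtNormed_map_eq_zero_of_shift (hf : ∀ t, f (t + k) = T (f t)) {s t : ℕ}
    (h : s + k < t) :
    inner 𝕜 (gramSchmidtNormed 𝕜 f t) (T (gramSchmidtNormed 𝕜 f s)) = 0 := by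
  refine inner_gramSchmidtNormed_eq_zero_of_mem_span f (span_mono ?_
    (map_mem_span_image_Iio_of_shift hf (gramSchmidtNormed_mem_span_image_Iio_succ f s)))
  exact Set.image_mono (Set.Iio_subset_Iio (by lia))

theorem inner_gramSchmidtNormed_map_of_shift (hf : ∀ t, f (t + k) = T (f t)) (t : ℕ) :
    inner 𝕜 (gramSchmidtNormed 𝕜 f (t + k)) (T (gramSchmidtNormed 𝕜 f t)) =
      ((‖gramSchmidt 𝕜 f t‖⁻¹ * ‖gramSchmidt 𝕜 f (t + k)‖ : ℝ) : 𝕜) := by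
  have hsub : inner 𝕜 (gramSchmidtNormed 𝕜 f (t + k)) (T (f t - gramSchmidt 𝕜 f t)) = 0 :=
    inner_gramSchmidtNormed_eq_zero_of_mem_span f
      (map_mem_span_image_Iio_of_shift hf (sub_gramSchmidt_mem_span_image_Iio f t))
  rw [map_sub, inner_sub_right, ← hf, inner_gramSchmidtNormed_self, sub_eq_zero] at hsub
  rw [gramSchmidtNormed.eq_def _ _ t, map_smul, inner_smul_right, ← hsub, RCLike.ofReal_mul,
    RCLike.ofReal_inv]

theorem inner_gramSchmidtNormed_map_pos_of_shift (hf : ∀ t, f (t + k) = T (f t)) {t : ℕ}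
    (h₀ : gramSchmidtNormed 𝕜 f t ≠ 0) (hk : gramSchmidtNormed 𝕜 f (t + k) ≠ 0) :
    0 < inner 𝕜 (gramSchmidtNormed 𝕜 f (t + k)) (T (gramSchmidtNormed 𝕜 f t)) := by
  have norm_pos : ∀ i, gramSchmidtNormed 𝕜 f i ≠ 0 → 0 < ‖gramSchmidt 𝕜 f i‖ := fun i hi =>
    norm_pos_iff.2 (right_ne_zero_of_smul hi)
  rw [inner_gramSchmidtNormed_map_of_shift hf]
  exact RCLike.ofReal_pos.2 (mul_pos (inv_pos.2 (norm_pos _ h₀)) (norm_pos _ hk))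

end Shift

section KrylovSequence

open Submodule

variable {𝕜 E : Type*} [Semiring 𝕜] [AddCommMonoid E] [Module 𝕜 E] {k : ℕ} [NeZero k]

/-- The vectors `b 0, …, b (k - 1), T (b 0), …, T (b (k - 1)), T² (b 0), …` listed as one sequence:
the columns of all the block Krylov matrices of `T` and `b`, read from left to right. -/
def krylovSequence (T : E →ₗ[𝕜] E) (b : Fin k → E) (t : ℕ) : E :=
  (T ^ (t / k)) (b (Fin.ofNat k t))

variable (T : E →ₗ[𝕜] E) (b : Fin k → E)

theorem krylovSequence_add (t : ℕ) : krylovSequence T b (t + k) = T (krylovSequence T b t) := by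
  have hmod : Fin.ofNat k (t + k) = Fin.ofNat k t := Fin.ext (Nat.add_mod_right t k)
  rw [krylovSequence, Nat.add_div_right t (NeZero.pos k), hmod, pow_succ', Module.End.mul_apply,
    krylovSequence]

theorem krylovSequence_mul_add (i : ℕ) (c : Fin k) :
    krylovSequence T b (c + k * i) = (T ^ i) (b c) := by
  have hmod : Fin.ofNat k (c + k * i) = c :=
    Fin.ext (by rw [Fin.val_ofNat, Nat.add_mul_mod_self_left, Nat.mod_eq_of_lt c.2])
  rw [krylovSequence, hmod, Nat.add_mul_div_left _ _ (NeZero.pos k), Nat.div_eq_of_lt c.2, zero_add]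

theorem krylovSequence_val (c : Fin k) : krylovSequence T b c = b c := by
  simpa using krylovSequence_mul_add T b 0 c

end KrylovSequence

theorem finrank_span_krylovSequence_eq_rank_blockKrylov {𝕜 ι : Type*} [RCLike 𝕜] [Fintype ι]
    [DecidableEq ι] {k : ℕ} [NeZero k] (A : Matrix ι ι 𝕜) (B : Matrix ι (Fin k) 𝕜) (d : ℕ) :
    Module.finrank 𝕜 (Submodule.span 𝕜 (krylovSequence (Matrix.toEuclideanLin A)
      (fun c => WithLp.toLp 2 (B.col c)) '' Set.Iio ((d + 1) * k))) = (blockKrylov A B d).rank := by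
  set f := krylovSequence (Matrix.toEuclideanLin A) fun c => WithLp.toLp 2 (B.col c)
  have hcol : ∀ c : Fin (d + 1) × Fin k,
      (WithLp.linearEquiv 2 𝕜 (ι → 𝕜)).symm ((blockKrylov A B d).col c) =
        f (finProdFinEquiv c) := by
    rintro ⟨i, c⟩
    have h := krylovSequence_mul_add (Matrix.toEuclideanLin A)
      (fun c => WithLp.toLp 2 (B.col c)) i c
    rw [← Matrix.toLpLin_pow, Matrix.toLpLin_toLp] at h
    rw [finProdFinEquiv_apply_val]
    exact h.symm
  have himage : f '' Set.Iio ((d + 1) * k) =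
      (WithLp.linearEquiv 2 𝕜 (ι → 𝕜)).symm '' Set.range (blockKrylov A B d).col := by
    rw [← Fin.range_val, ← Set.range_comp, ← Set.range_comp,
      ← finProdFinEquiv.surjective.range_comp]
    exact congrArg Set.range (funext fun c => (hcol c).symm)
  rw [himage, ← LinearEquiv.coe_coe, Submodule.span_image, LinearEquiv.finrank_map_eq,
    Matrix.rank_eq_finrank_span_cols]

/-! ### Banded matrices have Krylov matrices of full rank -/

/-- The first `k` columns of the identity matrix. -/
def firstColumns {k N : ℕ} (hkN : k ≤ N) : Matrix (Fin N) (Fin k) ℂ :=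
  (1 : Matrix (Fin N) (Fin N) ℂ).submatrix id (Fin.castLE hkN)

theorem conjTranspose_firstColumns_mul_mul {k N : ℕ} (hkN : k ≤ N)
    (A : Matrix (Fin N) (Fin N) ℂ) :
    (firstColumns hkN)ᴴ * A * firstColumns hkN =
      A.submatrix (Fin.castLE hkN) (Fin.castLE hkN) := by
  ext a b
  simp [firstColumns, Matrix.mul_apply, Matrix.one_apply]

theorem HasFullRank.surjective_mulVec {p q : Type*} [Fintype p] [Fintype q]
    {M : Matrix p q ℂ} (h : HasFullRank M) (hpq : Fintype.card p ≤ Fintype.card q) :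
    Function.Surjective M.mulVec := by
  have hrange : Module.finrank ℂ M.mulVecLin.range = Module.finrank ℂ (p → ℂ) := by
    rw [Module.finrank_fintype_fun_eq_card]
    exact h.trans (min_eq_left hpq)
  exact LinearMap.range_eq_top.1 (Submodule.eq_top_of_finrank_eq hrange)


section Blocks

variable {k N : ℕ}

theorem lt_ceilDiv_iff_mul_lt [NeZero k] {b : ℕ} : b < N ⌈/⌉ k ↔ b * k < N := by
  rw [← not_le, ceilDiv_le_iff_le_mul (NeZero.pos k), not_le, mul_comm]

theorem blockSize_eq_of_succ_mul_le {b : ℕ} (h : (b + 1) * k ≤ N) : blockSize k N b = k :=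
  min_eq_left (by lia)

theorem blockIndex_lt_succ_mul (b : ℕ) (r : Fin (blockSize k N b)) :
    (blockIndex k N b r : ℕ) < (b + 1) * k := by
  have hr := r.2.trans_le (min_le_left k _)
  rw [blockIndex, add_one_mul]
  lia

theorem exists_blockIndex_eq {b : ℕ} {i : Fin N} (hle : b * k ≤ i) (hlt : i < (b + 1) * k) :
    ∃ r, blockIndex k N b r = i :=
  ⟨⟨i - b * k, lt_min (by lia) (by lia)⟩, Fin.ext (Nat.add_sub_of_le hle)⟩

theorem IsBanded.apply_eq_zero [NeZero k] {J : Matrix (Fin N) (Fin N) ℂ} (hJ : IsBanded k N J)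
    {i j : Fin N} (h : (j : ℕ) / k + 1 < i / k) : J i j = 0 := by
  have hindex : ∀ l : Fin N, ∃ r, blockIndex k N (l / k) r = l := fun l =>
    exists_blockIndex_eq (Nat.div_mul_le_self _ _)
      (Nat.lt_mul_of_div_lt (lt_add_one _) (NeZero.pos k))
  obtain ⟨r, hr⟩ := hindex i
  obtain ⟨c, hc⟩ := hindex j
  have hlt : ∀ l : Fin N, (l : ℕ) / k < N ⌈/⌉ k := fun l =>
    lt_ceilDiv_iff_mul_lt.2 ((Nat.div_mul_le_self _ _).trans_lt l.2)
  have hblock := congrFun₂ (hJ.tridiagonal _ (hlt i) _ (hlt j) (Or.inr h)) r c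
  rwa [block, Matrix.submatrix_apply, hr, hc] at hblock

end Blocks

section Necessity

open Submodule

/-- The vectors of `ℂ^N` whose only nonzero coordinates are among the first `t`. -/
def leadingSubspace (N t : ℕ) : Submodule ℂ (EuclideanSpace ℂ (Fin N)) :=
  span ℂ (EuclideanSpace.basisFun (Fin N) ℂ '' {i | (i : ℕ) < t})

variable {k N : ℕ}

theorem basisFun_mem_leadingSubspace {t : ℕ} {i : Fin N} (hi : (i : ℕ) < t) :
    EuclideanSpace.basisFun (Fin N) ℂ i ∈ leadingSubspace N t :=
  subset_span (Set.mem_image_of_mem _ hi)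

theorem mem_leadingSubspace_iff {t : ℕ} {v : EuclideanSpace ℂ (Fin N)} :
    v ∈ leadingSubspace N t ↔ ∀ i : Fin N, t ≤ i → v i = 0 := by
  rw [leadingSubspace, ← OrthonormalBasis.coe_toBasis, Module.Basis.mem_span_image]
  simp [Set.subset_def, not_imp_comm]

theorem finrank_leadingSubspace (N t : ℕ) :
    Module.finrank ℂ (leadingSubspace N t) = min N t := by
  have hli := ((EuclideanSpace.basisFun (Fin N) ℂ).orthonormal.comp
    (fun i : {i : Fin N | (i : ℕ) < t} => (i : Fin N)) Subtype.val_injective).linearIndependent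
  rw [leadingSubspace, Set.image_eq_range]
  refine (finrank_span_eq_card hli).trans ?_
  rw [Fintype.card_subtype]
  exact Fin.card_filter_val_lt

variable {J : Matrix (Fin N) (Fin N) ℂ}

theorem IsBanded.exists_sub_mem_leadingSubspace [NeZero k] (hJ : IsBanded k N J) (d : ℕ)
    {v : EuclideanSpace ℂ (Fin N)} (hv : v ∈ leadingSubspace N ((d + 2) * k)) :
    ∃ u ∈ leadingSubspace N ((d + 1) * k),
      v - Matrix.toEuclideanLin J u ∈ leadingSubspace N ((d + 1) * k) := by
  simp only [mem_leadingSubspace_iff] at hv ⊢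
  rcases le_or_gt N ((d + 1) * k) with hN | hN
  · exact ⟨0, fun _ _ => rfl, fun i hi => absurd i.2 (by lia)⟩
  have hfull := hJ.fullRank d (lt_ceilDiv_iff_mul_lt.2 hN)
  obtain ⟨w, hw⟩ := hfull.surjective_mulVec
    (by simp only [Fintype.card_fin, blockSize_eq_of_succ_mul_le hN.le]; exact min_le_left _ _)
    fun r => v (blockIndex k N (d + 1) r)
  set u : EuclideanSpace ℂ (Fin N) :=
    ∑ c, w c • EuclideanSpace.basisFun (Fin N) ℂ (blockIndex k N d c)
  have hu : u ∈ leadingSubspace N ((d + 1) * k) := sum_mem fun c _ =>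
    smul_mem _ _ (basisFun_mem_leadingSubspace (blockIndex_lt_succ_mul d c))
  have hJu : ∀ i, Matrix.toEuclideanLin J u i = ∑ c, J i (blockIndex k N d c) * w c := by
    intro i
    simp [u, mul_comm]
  refine ⟨u, mem_leadingSubspace_iff.1 hu, fun i hi => ?_⟩
  rw [PiLp.sub_apply, sub_eq_zero, hJu]
  rcases lt_or_ge (i : ℕ) ((d + 2) * k) with hi' | hi'
  · obtain ⟨r, rfl⟩ := exists_blockIndex_eq hi hi'
    exact (congrFun hw r).symm
  · rw [hv i hi']
    refine (Finset.sum_eq_zero fun c _ => ?_).symm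
    have hc := (Nat.div_lt_iff_lt_mul (NeZero.pos k)).2 (blockIndex_lt_succ_mul d c)
    have hd := (Nat.le_div_iff_mul_le (NeZero.pos k)).2 hi'
    rw [hJ.apply_eq_zero (by lia), zero_mul]

theorem IsBanded.leadingSubspace_le_span_image_Iio [NeZero k] (hJ : IsBanded k N J)
    {f : ℕ → EuclideanSpace ℂ (Fin N)} (hf : ∀ t, f (t + k) = Matrix.toEuclideanLin J (f t))
    (hf₀ : ∀ i : Fin N, (i : ℕ) < k → f i = EuclideanSpace.basisFun (Fin N) ℂ i) (d : ℕ) :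
    leadingSubspace N ((d + 1) * k) ≤ span ℂ (f '' Set.Iio ((d + 1) * k)) := by
  induction d with
  | zero =>
    rw [zero_add, one_mul]
    refine span_mono ?_
    rintro _ ⟨i, hi, rfl⟩
    exact ⟨i, hi, hf₀ i hi⟩
  | succ d ih =>
    intro v hv
    obtain ⟨u, hu, hvu⟩ := hJ.exists_sub_mem_leadingSubspace d hv
    have hle : (d + 1 + 1) * k = (d + 1) * k + k := add_one_mul _ _
    rw [← sub_add_cancel v (Matrix.toEuclideanLin J u), hle]
    exact add_mem (span_mono (Set.image_mono (Set.Iio_subset_Iio (Nat.le_add_right _ _))) (ih hvu))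
      (map_mem_span_image_Iio_of_shift hf (ih hu))

theorem IsBanded.hasFullRank_blockKrylov [NeZero k] (hJ : IsBanded k N J) (hkN : k ≤ N) (d : ℕ) :
    HasFullRank (blockKrylov J (firstColumns hkN) d) := by
  refine le_antisymm (le_min (Matrix.rank_le_card_height _) (Matrix.rank_le_card_width _)) ?_
  rw [Fintype.card_prod, Fintype.card_fin, Fintype.card_fin, Fintype.card_fin,
    ← finrank_leadingSubspace, ← finrank_span_krylovSequence_eq_rank_blockKrylov]
  refine finrank_mono (hJ.leadingSubspace_le_span_image_Iio (krylovSequence_add _ _) ?_ d)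
  intro i hi
  rw [← Fin.val_mk hi, krylovSequence_val]
  ext j
  simp [firstColumns, Matrix.one_apply]

end Necessity

/-! ### Gram–Schmidt bases of Krylov sequences -/

section Echelon

variable {m n : Type*} [LinearOrder m] [LinearOrder n] {π : m → n}

theorem isPivotedBy_of_isLeadingEntry {R : Type*} [Zero R] {M : Matrix m n R} (hπ : StrictMono π)
    (h : ∀ r, M.IsLeadingEntry r (π r)) : M.IsPivotedBy fun r => π r :=
  Matrix.isPivotedBy_iff'.2 ⟨WithTop.coe_mono.comp hπ.monotone,
    (WithTop.coe_strictMono.comp hπ).strictMonoOn _, fun r => Or.inr ⟨π r, rfl, h r⟩⟩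

theorem hasFullRank_of_isLeadingEntry [Fintype m] [Fintype n] {M : Matrix m n ℂ}
    (hπ : StrictMono π) (h : ∀ r, M.IsLeadingEntry r (π r)) : HasFullRank M := by
  rw [HasFullRank, (isPivotedBy_of_isLeadingEntry hπ h).rank_eq,
    min_eq_left (Fintype.card_le_of_injective π hπ.injective)]
  simp

end Echelon

/-- `J` is the matrix of an operator `T` in an orthonormal basis obtained by Gram–Schmidt from a
sequence `f` with `f (t + k) = T (f t)`, the `s`-th basis vector coming from the `p s`-th term.
In row `r` the first nonzero entry is positive and sits in the column `c` with `p c + k = p r`;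
`p` skips no position below a multiple `d * k ≤ N`. -/
structure IsStaircase (k : ℕ) {N : ℕ} (p : Fin N → ℕ) (J : Matrix (Fin N) (Fin N) ℂ) : Prop where
  strictMono : StrictMono p
  lt_mul_iff : ∀ d s, p s < d * k ↔ (s : ℕ) < d * k
  apply_eq_zero : ∀ r c, p c + k < p r → J r c = 0
  apply_pos : ∀ r c, p c + k = p r → 0 < J r c

namespace IsStaircase

variable {k N : ℕ} {p : Fin N → ℕ} {J : Matrix (Fin N) (Fin N) ℂ}

theorem apply_eq_self (h : IsStaircase k p J) {d : ℕ} (hd : d * k ≤ N) {s : Fin N}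
    (hs : (s : ℕ) < d * k) : p s = s := by
  let φ : Fin (d * k) → Fin (d * k) := fun i =>
    ⟨p (Fin.castLE hd i), (h.lt_mul_iff d _).2 i.2⟩
  have hφ : StrictMono φ := fun _ _ hij => h.strictMono hij
  have hfix : φ ⟨s, hs⟩ = ⟨s, hs⟩ := le_antisymm hφ.apply_le hφ.le_apply
  exact congrArg Fin.val hfix

theorem apply_blockIndex (h : IsStaircase k p J) {b : ℕ} (hb : (b + 1) * k ≤ N)
    (c : Fin (blockSize k N b)) : p (blockIndex k N b c) = b * k + c :=
  h.apply_eq_self hb (blockIndex_lt_succ_mul b c)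

theorem mul_le_apply_blockIndex (h : IsStaircase k p J) (a : ℕ) (r : Fin (blockSize k N a)) :
    a * k ≤ p (blockIndex k N a r) :=
  not_lt.1 fun hlt => (Nat.le_add_right (a * k) r).not_gt ((h.lt_mul_iff a _).1 hlt)

theorem block_eq_zero (h : IsStaircase k p J) {a b : ℕ} (hab : b + 1 < a) (ha : a * k ≤ N) :
    block (k := k) J a b = 0 := by
  have hmul : (b + 1) * k + k ≤ a * k := by
    rw [← add_one_mul]
    exact Nat.mul_le_mul_right k hab
  ext r c
  refine h.apply_eq_zero _ _ (lt_of_lt_of_le ?_ (h.mul_le_apply_blockIndex a r))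
  rw [h.apply_eq_self (by lia) (blockIndex_lt_succ_mul b c)]
  have := blockIndex_lt_succ_mul b c
  lia

theorem exists_strictMono_isLeadingEntry (h : IsStaircase k p J) {j : ℕ} (hj : (j + 1) * k ≤ N) :
    ∃ π : Fin (blockSize k N (j + 1)) → Fin (blockSize k N j), StrictMono π ∧
      ∀ r, (block (k := k) J (j + 1) j).IsLeadingEntry r (π r) ∧
        0 < block (k := k) J (j + 1) j r (π r) := by
  have hπ : ∀ r : Fin (blockSize k N (j + 1)), ∃ c : Fin (blockSize k N j),
      p (blockIndex k N (j + 1) r) = (j + 1) * k + c := by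
    intro r
    have hle := h.mul_le_apply_blockIndex (j + 1) r
    have hlt := (h.lt_mul_iff (j + 2) _).2 (blockIndex_lt_succ_mul (j + 1) r)
    refine ⟨⟨p (blockIndex k N (j + 1) r) - (j + 1) * k, ?_⟩, (Nat.add_sub_of_le hle).symm⟩
    rw [blockSize_eq_of_succ_mul_le hj]
    lia
  choose π hπ using hπ
  have hcol : ∀ c, p (blockIndex k N j c) + k = (j + 1) * k + c := by
    intro c
    rw [h.apply_blockIndex hj, add_one_mul, add_right_comm]
  have hpos : ∀ r, 0 < block (k := k) J (j + 1) j r (π r) := fun r =>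
    h.apply_pos _ _ ((hcol _).trans (hπ r).symm)
  refine ⟨π, fun r s hrs => ?_, fun r => ⟨⟨fun c hc => ?_, (hpos r).ne'⟩, hpos r⟩⟩
  · have hlt : p (blockIndex k N (j + 1) r) < p (blockIndex k N (j + 1) s) :=
      h.strictMono (Nat.add_lt_add_left hrs _)
    rw [hπ, hπ] at hlt
    exact Nat.lt_of_add_lt_add_left hlt
  · refine h.apply_eq_zero _ _ ?_
    rw [hcol, hπ]
    exact Nat.add_lt_add_left hc _

theorem isBanded [NeZero k] (h : IsStaircase k p J) (hJ : J.IsHermitian) : IsBanded k N J where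
  isHermitian := hJ
  diag_isHermitian j _ := hJ.submatrix _
  tridiagonal := by
    rintro a ha b hb (hab | hab)
    · rw [← Matrix.conjTranspose_eq_zero, block, Matrix.conjTranspose_submatrix, hJ.eq]
      exact h.block_eq_zero hab (lt_ceilDiv_iff_mul_lt.1 hb).le
    · exact h.block_eq_zero hab (lt_ceilDiv_iff_mul_lt.1 ha).le
  fullRank j hj := by
    obtain ⟨π, hπ, hlead⟩ := h.exists_strictMono_isLeadingEntry (lt_ceilDiv_iff_mul_lt.1 hj).le
    exact hasFullRank_of_isLeadingEntry hπ fun r => (hlead r).1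
  upperTriangular j hj r c hcr := by
    have hj' := lt_ceilDiv_iff_mul_lt.1 hj
    refine h.apply_eq_zero _ _ ?_
    rw [h.apply_blockIndex hj'.le, h.apply_blockIndex (by lia)]
    lia
  diag_pos j hj r c hrc := by
    have hj' := lt_ceilDiv_iff_mul_lt.1 hj
    refine h.apply_pos _ _ ?_
    rw [h.apply_blockIndex hj'.le, h.apply_blockIndex (by lia)]
    lia
  last_isRowEchelon j hj := by
    obtain ⟨π, hπ, hlead⟩ :=
      h.exists_strictMono_isLeadingEntry (lt_ceilDiv_iff_mul_lt.1 (show j + 1 < N ⌈/⌉ k by lia)).le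
    exact (isPivotedBy_of_isLeadingEntry hπ fun r => (hlead r).1).isRowEchelon
  last_pivot_pos j hj r c hrc := by
    obtain ⟨π, -, hlead⟩ :=
      h.exists_strictMono_isLeadingEntry (lt_ceilDiv_iff_mul_lt.1 (show j + 1 < N ⌈/⌉ k by lia)).le
    rw [hrc.unique (hlead r).1]
    exact (hlead r).2

end IsStaircase

theorem exists_orthonormalBasis_isBanded {E : Type*} [NormedAddCommGroup E] [InnerProductSpace ℂ E]
    [FiniteDimensional ℂ E] {k N : ℕ} [NeZero k] (hkN : k ≤ N) (hN : Module.finrank ℂ E = N)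
    {T : E →ₗ[ℂ] E} (hT : T.IsSymmetric) {b : Fin k → E} (hb : Orthonormal ℂ b)
    (h : ∀ d, Module.finrank ℂ (Submodule.span ℂ (krylovSequence T b '' Set.Iio ((d + 1) * k))) =
      min N ((d + 1) * k)) :
    ∃ q : OrthonormalBasis (Fin N) ℂ E, (∀ c, q (Fin.castLE hkN c) = b c) ∧
      IsBanded k N (LinearMap.toMatrixOrthonormal q T) := by
  set f := krylovSequence T b
  have hf : ∀ t, f (t + k) = T (f t) := krylovSequence_add T b
  have hfb : ∀ c : Fin k, f c = b c := krylovSequence_val T b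
  have hNk : N ≤ (N + 1) * k := N.le_succ.trans (Nat.le_mul_of_pos_right _ (NeZero.pos k))
  obtain ⟨q, p, hp, hq, hlt⟩ :=
    exists_orthonormalBasis_gramSchmidtNormed f hN ((h N).trans (min_eq_left hNk))
  have hne : ∀ s, InnerProductSpace.gramSchmidtNormed ℂ f (p s) ≠ 0 := fun s =>
    hq s ▸ q.orthonormal.ne_zero s
  have hstair : IsStaircase k p (LinearMap.toMatrixOrthonormal q T) := by
    refine ⟨hp, fun d s => ?_, fun r c hrc => ?_, fun r c hrc => ?_⟩
    · cases d with
      | zero => simp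
      | succ d => rw [hlt, h, lt_min_iff, and_iff_right s.2]
    · rw [LinearMap.toMatrixOrthonormal_apply_apply, hq, hq]
      exact inner_gramSchmidtNormed_map_eq_zero_of_shift hf hrc
    · rw [LinearMap.toMatrixOrthonormal_apply_apply, hq, hq, ← hrc]
      exact inner_gramSchmidtNormed_map_pos_of_shift hf (hne c) (hrc ▸ hne r)
  refine ⟨q, fun c => ?_, hstair.isBanded
    (((LinearMap.isSymmetric_iff_isSelfAdjoint T).1 hT).map (LinearMap.toMatrixOrthonormal q))⟩
  have hgs : InnerProductSpace.gramSchmidt ℂ f c = b c := by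
    rw [gramSchmidt_eq_self_of_inner_eq_zero, hfb]
    intro i hi
    rw [hfb, ← Fin.val_mk (hi.trans c.2), hfb]
    exact hb.inner_eq_zero (Fin.ne_of_val_ne hi.ne)
  rw [hq, hstair.apply_eq_self (d := 1) (by rwa [one_mul]) (by simp), Fin.val_castLE,
    InnerProductSpace.gramSchmidtNormed, hgs, hb.norm_eq_one, RCLike.ofReal_one, inv_one, one_smul]

section Matrix

variable {ι : Type*} [Fintype ι] [DecidableEq ι] {k N : ℕ}

theorem inner_toLp_col_toEuclideanLin_pow (A : Matrix ι ι ℂ) (B : Matrix ι (Fin k) ℂ) (i : ℕ)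
    (a c : Fin k) :
    inner ℂ (WithLp.toLp 2 (B.col a)) ((Matrix.toEuclideanLin A ^ i) (WithLp.toLp 2 (B.col c))) =
      (Bᴴ * A ^ i * B) a c := by
  rw [← Matrix.toLpLin_pow, Matrix.toLpLin_toLp, EuclideanSpace.inner_toLp_toLp, Matrix.mul_assoc,
    dotProduct_comm]
  rfl

theorem exists_isBanded_iff_forall_hasFullRank_blockKrylov [NeZero k] (hkN : k ≤ N)
    (hN : Fintype.card ι = N) {A : Matrix ι ι ℂ} (hA : A.IsHermitian) {B : Matrix ι (Fin k) ℂ}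
    (hB : Bᴴ * B = 1) :
    (∃ J : Matrix (Fin N) (Fin N) ℂ, IsBanded k N J ∧
      ∀ i, (J ^ i).submatrix (Fin.castLE hkN) (Fin.castLE hkN) = Bᴴ * A ^ i * B) ↔
    ∀ d, HasFullRank (blockKrylov A B d) := by
  constructor
  · rintro ⟨J, hJ, hmoments⟩ d
    have hrank : (blockKrylov J (firstColumns hkN) d).rank = (blockKrylov A B d).rank :=
      rank_blockKrylov_eq_of_moments hJ.isHermitian hA (fun i => by
        rw [conjTranspose_firstColumns_mul_mul, hmoments]) d
    rw [HasFullRank, ← hrank, hJ.hasFullRank_blockKrylov hkN d, Fintype.card_fin, hN]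
  · intro h
    set T := Matrix.toEuclideanLin A
    set b : Fin k → EuclideanSpace ℂ ι := fun c => WithLp.toLp 2 (B.col c)
    have hmoments : ∀ i a c, inner ℂ (b a) ((T ^ i) (b c)) = (Bᴴ * A ^ i * B) a c :=
      inner_toLp_col_toEuclideanLin_pow A B
    have hb : Orthonormal ℂ b := orthonormal_iff_ite.2 fun a c => by
      simpa [hB, Matrix.one_apply] using hmoments 0 a c
    obtain ⟨q, hqb, hJ⟩ := exists_orthonormalBasis_isBanded (b := b) hkN
      (finrank_euclideanSpace.trans hN) (Matrix.isSymmetric_toEuclideanLin_iff.2 hA) hb fun d => by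
        rw [finrank_span_krylovSequence_eq_rank_blockKrylov, h d, hN, Fintype.card_prod,
          Fintype.card_fin, Fintype.card_fin]
    refine ⟨_, hJ, fun i => ?_⟩
    ext a c
    rw [← map_pow, Matrix.submatrix_apply, LinearMap.toMatrixOrthonormal_apply_apply, hqb, hqb,
      hmoments]

end Matrix

end BandedSpectral

end

theorem mainTheorem5_general {k N m : ℕ} (hk : 1 ≤ k) (hkN : k ≤ N) (x : Fin m → ℝ)
    (n : Fin m → ℕ) (hN : ∑ j, n j = N) (V : ∀ j, Matrix (Fin k) (Fin (n j)) ℂ)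
    (hV : ∑ j, V j * (V j)ᴴ = 1) :
    (∃ (J : Matrix (Fin N) (Fin N) ℂ) (hJ : BandedSpectral.IsBanded k N J),
      BandedSpectral.spectralMeasure hkN J hJ.isHermitian =
        BandedSpectral.atomicMeasure x fun j => V j * (V j)ᴴ) ↔
    ∀ d : ℕ, BandedSpectral.HasFullRank (BandedSpectral.krylovMatrix x V d) := by
  have : NeZero k := ⟨by lia⟩
  have hcard : Fintype.card (Σ j, Fin (n j)) = N := by simpa using hN
  simp only [BandedSpectral.spectralMeasure_eq_atomicMeasure_iff, exists_prop]
  exact BandedSpectral.exists_isBanded_iff_forall_hasFullRank_blockKrylov hkN hcard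
    (BandedSpectral.isHermitian_pointMatrix x n)
    ((BandedSpectral.conjTranspose_stackedMatrix_mul_self V).trans hV)

theorem mainTheorem5 {k N m : ℕ} (hk : 1 ≤ k) (hkN : k ≤ N)
    (x : Fin m → ℝ) (hx : Function.Injective x)
    (n : Fin m → ℕ) (hn : ∀ j, n j ≤ k) (hN : ∑ j, n j = N)
    (V : ∀ j, Matrix (Fin k) (Fin (n j)) ℂ)
    (hμ : BandedSpectral.IsNormalizedMeasure
      (BandedSpectral.atomicMeasure x fun j => V j * (V j)ᴴ)) :
    (∃ (J : Matrix (Fin N) (Fin N) ℂ) (hJ : BandedSpectral.IsBanded k N J),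
      BandedSpectral.spectralMeasure hkN J hJ.isHermitian =
        BandedSpectral.atomicMeasure x fun j => V j * (V j)ᴴ) ↔
    ∀ d : ℕ, BandedSpectral.HasFullRank (BandedSpectral.krylovMatrix x V d) :=
  mainTheorem5_general hk hkN x n hN V ((BandedSpectral.atomicMeasure_univ x _).symm.trans hμ.2)
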